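/- Let $\Sigma\in\mathbb R^{d\times d}$ be symmetric positive definite, $V(x)=\tfrac12x^\top\Sigma^{-1}x$, and let $m$ and $L$ be the smallest and largest eigenvalues of $\nabla^2V=\Sigma^{-1}$, $\kappa=L/m$ the condition number, and $\xi_{\min}=L^{-1}$ the smallest eigenvalue of $\Sigma$. For $\beta,T,\eta>0$ the backwards regularized Wasserstein proximal (BRWP) scheme is $$X_{k+1}=X_k-\eta\nabla V(X_k)-\eta\beta\nabla\log\rho_{k,T}(X_k),\qquad \rho_{k,T}(x)=\int K(x,y)\,\rho_k(dy),$$ where $\rho_k$ is the law of $X_k$ and $$K(x,y)=\frac{\exp\!\big(-\frac1{2\beta}(V(x)+\frac{\|x-y\|^2}{2T})\big)}{\int_{\mathbb R^d}\exp\!\big(-\frac1{2\beta}(V(z)+\frac{\|z-y\|^2}{2T})\big)dz}.$$ Take $T=\xi_{\min}/3$ and let $\eta$ be the maximal allowed step size, i.e. the largest $\eta>0$ with $\eta\,\xi^{-1}\le 1/\Delta(\xi,T)$ for every eigenvalue $\xi$ of $\Sigma$, where $\Delta(\xi,T)=\frac12\big(\sqrt{(\xi+T)/(2T)}+1\big)$.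 Let $\Pi=\mathcal N\big(0,\ \beta(I-T\Sigma^{-1})\Sigma(I+T\Sigma^{-1})\big)$, $\mathrm{TV}(P,Q)=\sup_A|P(A)-Q(A)|$ and $t_{\rm mix}(\delta;\rho_0)=\min\{k:\mathrm{TV}(\rho_k,\Pi)\le\delta\}$. Fix $\beta>0$. (a) There is a constant $C=C(\beta)$ such that for all $d$ and all $\Sigma$ as above, with $\rho_0=\mathcal N\big(0,\,L^{-1}(1-L^{2}T^{2})\,I\big)$, one has $\mathrm{TV}(\rho_k,\Pi)\to0$ and, for all $\delta\in(0,1)$, $$t_{\rm mix}(\delta;\rho_0)\le C\,\kappa^{3/2}\log(\kappa\sqrt d/\delta).$$ (b) For every $r>0$ there is a constant $C=C(\beta,r)$ such that the same conclusions hold, for all $d$ and all $\Sigma$ with $1-L^{-2}T^{2}\ge r$, with $\rho_0=\mathcal N\big(0,\,L^{-1}(1-L^{-2}T^{2})^{-1}I\big)$. -/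

import Mathlib

open MeasureTheory ProbabilityTheory Filter Topology Matrix

noncomputable section

namespace BRWP

variable {d : ℕ}

/-- Total variation between two (probability) measures:
`TV(P, Q) = sup_A |P(A) - Q(A)|` over measurable sets `A`. -/
def tvDist {Ω : Type*} [MeasurableSpace Ω] (P Q : Measure Ω) : ℝ :=
  ⨆ A : {A : Set Ω // MeasurableSet A}, |P.real A.1 - Q.real A.1|

/-- `t` is the `δ`-mixing time of the sequence of laws `P 0, P 1, …` towards `Q`, that is
`t = min {k | TV(P k, Q) ≤ δ}`; in particular this set is nonempty. -/
def IsMixingTime {Ω : Type*} [MeasurableSpace Ω] (P : ℕ → Measure Ω) (Q : Measure Ω)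
    (δ : ℝ) (t : ℕ) : Prop :=
  IsLeast {k : ℕ | tvDist (P k) Q ≤ δ} t

/-- The kernel `K(x, y)` of the regularized Wasserstein proximal,
`K(x, y) = exp(-(V(x) + |x-y|²/(2T))/(2β)) / ∫ exp(-(V(z) + |z-y|²/(2T))/(2β)) dz`. -/
def kernel (V : EuclideanSpace ℝ (Fin d) → ℝ) (β T : ℝ) (x y : EuclideanSpace ℝ (Fin d)) : ℝ :=
  Real.exp (-(1 / (2 * β)) * (V x + ‖x - y‖ ^ 2 / (2 * T))) /
    ∫ z, Real.exp (-(1 / (2 * β)) * (V z + ‖z - y‖ ^ 2 / (2 * T)))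

/-- The density `ρ_T(x) = ∫ K(x, y) ρ(dy)` of the regularized Wasserstein proximal of `ρ`. -/
def proxDensity (V : EuclideanSpace ℝ (Fin d) → ℝ) (β T : ℝ)
    (ρ : Measure (EuclideanSpace ℝ (Fin d))) (x : EuclideanSpace ℝ (Fin d)) : ℝ :=
  ∫ y, kernel V β T x y ∂ρ

/-- The update `X ↦ X - η ∇V(X) - η β ∇ log ρ_T(X)` of the scheme when `X` has law `ρ`. -/
def update (V : EuclideanSpace ℝ (Fin d) → ℝ) (β T η : ℝ)
    (ρ : Measure (EuclideanSpace ℝ (Fin d))) (x : EuclideanSpace ℝ (Fin d)) :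
    EuclideanSpace ℝ (Fin d) :=
  x - η • gradient V x - (η * β) • gradient (fun u => Real.log (proxDensity V β T ρ u)) x

/-- One step of the scheme on laws: the law of the updated particle. -/
def step (V : EuclideanSpace ℝ (Fin d) → ℝ) (β T η : ℝ)
    (ρ : Measure (EuclideanSpace ℝ (Fin d))) : Measure (EuclideanSpace ℝ (Fin d)) :=
  ρ.map (update V β T η ρ)

/-- The law of `X_k` when `X_0` has law `ρ₀`. -/
def law (V : EuclideanSpace ℝ (Fin d) → ℝ) (β T η : ℝ)
    (ρ₀ : Measure (EuclideanSpace ℝ (Fin d))) (k : ℕ) : Measure (EuclideanSpace ℝ (Fin d)) :=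
  (step V β T η)^[k] ρ₀

/-- The quadratic potential `V(x) = xᵀ S⁻¹ x / 2`. -/
def quadPotential (S : Matrix (Fin d) (Fin d) ℝ) (x : EuclideanSpace ℝ (Fin d)) : ℝ :=
  (1 / 2) * (WithLp.ofLp x ⬝ᵥ (S⁻¹ *ᵥ WithLp.ofLp x))

/-- `Δ(ξ, T) = (√((ξ + T) / (2T)) + 1) / 2`. -/
def stepDelta (ξ T : ℝ) : ℝ :=
  (1 / 2) * (Real.sqrt ((ξ + T) / (2 * T)) + 1)

/-- The allowed step sizes: `η > 0` with `η ξ⁻¹ ≤ 1 / Δ(ξ, T)` for every eigenvalue `ξ` of `S`. -/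
def allowedSteps (S : Matrix (Fin d) (Fin d) ℝ) (T : ℝ) : Set ℝ :=
  {η : ℝ | 0 < η ∧ ∀ ξ ∈ spectrum ℝ S, η * ξ⁻¹ ≤ 1 / stepDelta ξ T}

/-- The stationary law `N(0, β (I - T S⁻¹) S (I + T S⁻¹))` of the scheme. -/
def stationary (S : Matrix (Fin d) (Fin d) ℝ) (β T : ℝ) : Measure (EuclideanSpace ℝ (Fin d)) :=
  multivariateGaussian 0
    (β • ((1 - T • S⁻¹) * S * (1 + T • S⁻¹) : Matrix (Fin d) (Fin d) ℝ))

/-- The isotropic Gaussian `N(0, s I)`. -/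
def isoGaussian (d : ℕ) (s : ℝ) : Measure (EuclideanSpace ℝ (Fin d)) :=
  multivariateGaussian 0 (s • (1 : Matrix (Fin d) (Fin d) ℝ))

/-- The chain for the potential `xᵀ S⁻¹ x / 2`, started at `N(0, s I)`, converges in total
variation to the stationary law, and for every `δ ∈ (0, 1)` its `δ`-mixing time exists and is at
most `C κ^{3/2} log(κ √d / δ)`. -/
def MixesFast (S : Matrix (Fin d) (Fin d) ℝ) (β T η s κ C : ℝ) : Prop :=
  Tendsto (fun k => tvDist (law (quadPotential S) β T η (isoGaussian d s) k) (stationary S β T))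
      atTop (𝓝 0) ∧
  ∀ δ : ℝ, 0 < δ → δ < 1 →
    ∃ t : ℕ, IsMixingTime (law (quadPotential S) β T η (isoGaussian d s)) (stationary S β T) δ t ∧
      (t : ℝ) ≤ C * (κ ^ (3 / 2 : ℝ) * Real.log (κ * Real.sqrt d / δ))

end BRWP

end

/-! In an eigenbasis of $\Sigma$ everything decouples. The kernel factors over coordinates and the
proximal of a centred diagonal Gaussian is proportional to a Gaussian density, so the score is
linear and one step only rescales each coordinate (`step_basisGaussian`). The chain is thus a scalar
recursion for one variance $c$ per eigenvalue $a$ of $\Sigma^{-1}$.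

Put $v=ac/\beta$, $t=Ta$, $h=\eta a$, $q=2t(1+t)$. The recursion becomes
$f=\big(1-h+h(1+t)^2/(v+q)\big)^2v$, with fixed point $w=1-t^2$, the normalized stationary variance.
The step size bound is the discriminant condition under which $f$ never overshoots $w$. Hence
$v/(v+q)\ge p$ persists along the orbit, and each step shrinks $|v-w|$ by the factor $1-hp$
(`normalized_variance_step`). With $T=L^{-1}/3$ the isotropic start has $v$ proportional to $t$, as
$q$ is up to bounded factors, so $p$ does not depend on $\Sigma$.

The maximal $\eta$ is at least $L^{-1}/2$ (`half_min_mem_allowedSteps`), so $h\ge 1/(2\kappa)$ and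
all variance ratios approach $1$ like $(1-p/(2\kappa))^k$. Total variation is at most $2d$ times the
largest ratio error (`tvDist_basisGaussian_le`). This gives order $\kappa\log(\kappa\sqrt
d/\delta)$, and $\kappa\le\kappa^{3/2}$. The logarithm can be arbitrarily small only when $d=1$ and
$\delta$ is near $1$; there the initial law is already close enough. -/

namespace BRWP

/-! ### Total variation from one-sided domination. -/

section TotalVariation

variable {Ω : Type*} [MeasurableSpace Ω]

lemma tvDist_nonneg (P Q : Measure Ω) : 0 ≤ tvDist P Q :=
  Real.iSup_nonneg fun _ => abs_nonneg _

lemma tvDist_le_of_forall {P Q : Measure Ω} {B : ℝ}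
    (h : ∀ A, MeasurableSet A → |P.real A - Q.real A| ≤ B) : tvDist P Q ≤ B := by
  have : Nonempty {A : Set Ω // MeasurableSet A} := ⟨⟨∅, MeasurableSet.empty⟩⟩
  exact ciSup_le fun A => h A.1 A.2

/-- Domination on $A$ bounds $P(A)-Q(A)$ from above; domination on the complement bounds it from
below. -/
lemma abs_real_sub_real_le_of_dominated {P Q : Measure Ω} [IsProbabilityMeasure P]
    [IsProbabilityMeasure Q] {k : ℝ} (hk1 : k ≤ 1)
    (h : ∀ A, MeasurableSet A → k * P.real A ≤ Q.real A) {A : Set Ω} (hA : MeasurableSet A) :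
    |P.real A - Q.real A| ≤ 1 - k := by
  have h1 := h A hA
  have h2 := h Aᶜ hA.compl
  rw [probReal_compl_eq_one_sub hA, probReal_compl_eq_one_sub hA] at h2
  have h3 : P.real A ≤ 1 := measureReal_le_one
  have h4 : 0 ≤ P.real A := measureReal_nonneg
  rw [abs_le]
  constructor <;> nlinarith

end TotalVariation

/-! ### Domination between Gaussians and between product measures. -/

section Domination

/-- The product outer measure is the largest one bounded on boxes by the product of the side
measures, so it suffices to compare boxes. -/
lemma prod_mul_measure_pi_le {ι : Type*} [Fintype ι] {α : ι → Type*}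
    [∀ i, MeasurableSpace (α i)] (μ ν : ∀ i, Measure (α i)) [∀ i, SigmaFinite (μ i)]
    [∀ i, SigmaFinite (ν i)] (k : ι → ENNReal) (h : ∀ i s, k i * μ i s ≤ ν i s)
    {A : Set (∀ i, α i)} (hA : MeasurableSet A) :
    (∏ i, k i) * Measure.pi μ A ≤ Measure.pi ν A := by
  have key : ((∏ i, k i) • (Measure.pi μ).toOuterMeasure) ≤
      OuterMeasure.pi fun i => (ν i).toOuterMeasure := by
    rw [OuterMeasure.le_pi]
    intro s _
    change (∏ i, k i) * Measure.pi μ (Set.univ.pi s) ≤ ∏ i, ν i (s i)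
    rw [Measure.pi_pi, ← Finset.prod_mul_distrib]
    exact Finset.prod_le_prod' fun i _ => h i (s i)
  rw [show Measure.pi ν A = OuterMeasure.pi (fun i => (ν i).toOuterMeasure) A by
    rw [Measure.pi, toMeasure_apply _ _ hA]]
  exact key A

/-- The factor is the ratio of the normalizing constants; once it is removed, the wider Gaussian has
the larger exponential at every point. -/
lemma sqrt_div_mul_gaussianReal_le {c c' : NNReal} (hc : 0 < c) (hcc : c ≤ c') (s : Set ℝ) :
    ENNReal.ofReal (√(c / c')) * gaussianReal 0 c s ≤ gaussianReal 0 c' s := by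
  have hc' : 0 < c' := hc.trans_le hcc
  rw [gaussianReal_apply _ hc.ne', gaussianReal_apply _ hc'.ne',
    ← lintegral_const_mul _ (measurable_gaussianPDF 0 c)]
  refine lintegral_mono fun x => ?_
  rw [gaussianPDF, gaussianPDF, ← ENNReal.ofReal_mul (Real.sqrt_nonneg _)]
  refine ENNReal.ofReal_le_ofReal ?_
  have hcR : (0 : ℝ) < c := hc
  have hcR' : (0 : ℝ) < c' := hc'
  have hle : (c : ℝ) ≤ c' := hcc
  rw [gaussianPDFReal, gaussianPDFReal, ← mul_assoc]
  have h1 : √((c : ℝ) / c') * (√(2 * Real.pi * c))⁻¹ = (√(2 * Real.pi * c'))⁻¹ := by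
    rw [← Real.sqrt_inv, ← Real.sqrt_inv, ← Real.sqrt_mul (by positivity)]
    congr 1
    field_simp
  rw [h1]
  refine mul_le_mul_of_nonneg_left (Real.exp_le_exp.2 ?_) (by positivity)
  rw [neg_div, neg_div, neg_le_neg_iff]
  gcongr

end Domination

/-! ### Gaussians diagonal in an orthonormal basis and their total variation. -/

section BasisGaussian

variable {d : ℕ}

/-- The law of `∑ i, Z i • b i` for independent centred Gaussians `Z i` of variance `c i`. -/
noncomputable def basisGaussian (b : OrthonormalBasis (Fin d) ℝ (EuclideanSpace ℝ (Fin d)))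
    (c : Fin d → NNReal) : Measure (EuclideanSpace ℝ (Fin d)) :=
  (Measure.pi fun i => gaussianReal 0 (c i)).map fun w => b.repr.symm (WithLp.toLp 2 w)

variable (b : OrthonormalBasis (Fin d) ℝ (EuclideanSpace ℝ (Fin d)))

lemma measurable_repr_symm_toLp :
    Measurable fun w : Fin d → ℝ => b.repr.symm (WithLp.toLp 2 w) := by fun_prop

instance (c : Fin d → NNReal) : IsProbabilityMeasure (basisGaussian b c) :=
  Measure.isProbabilityMeasure_map (measurable_repr_symm_toLp b).aemeasurable

lemma charFun_basisGaussian (c : Fin d → NNReal) (x : EuclideanSpace ℝ (Fin d)) :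
    charFun (basisGaussian b c) x =
      Complex.exp (-((∑ i, c i * (b.repr x i) ^ 2 : ℝ) : ℂ) / 2) := by
  have h : charFun (basisGaussian b c) x =
      charFun ((Measure.pi fun i => gaussianReal 0 (c i)).map (WithLp.toLp 2)) (b.repr x) := by
    rw [charFun_apply, charFun_apply, basisGaussian, integral_map
      (measurable_repr_symm_toLp b).aemeasurable (by fun_prop), integral_map (by fun_prop)
      (by fun_prop)]
    refine integral_congr_ae (Eventually.of_forall fun w => ?_)
    simp only
    rw [← b.repr.inner_map_map (b.repr.symm _) x, LinearIsometryEquiv.apply_symm_apply]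
  rw [h, charFun_pi]
  simp_rw [charFun_gaussianReal, ← Complex.exp_sum]
  congr 1
  push_cast
  rw [neg_div, Finset.sum_div, ← Finset.sum_neg_distrib]
  refine Finset.sum_congr rfl fun i _ => ?_
  ring

lemma multivariateGaussian_eq_basisGaussian {M : Matrix (Fin d) (Fin d) ℝ} (hM : M.PosSemidef)
    (c : Fin d → NNReal)
    (h : ∀ x : EuclideanSpace ℝ (Fin d),
      WithLp.ofLp x ⬝ᵥ M *ᵥ WithLp.ofLp x = ∑ i, c i * (b.repr x i) ^ 2) :
    multivariateGaussian 0 M = basisGaussian b c := by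
  refine Measure.ext_of_charFun (funext fun x => ?_)
  rw [charFun_multivariateGaussian hM, charFun_basisGaussian, ← h]
  congr 1
  simp [neg_div]

lemma map_basisGaussian (c : Fin d → NNReal) (l : Fin d → ℝ)
    (f : EuclideanSpace ℝ (Fin d) → EuclideanSpace ℝ (Fin d))
    (hf : ∀ x i, b.repr (f x) i = l i * b.repr x i) :
    (basisGaussian b c).map f =
      basisGaussian b fun i => .mk (l i ^ 2) (sq_nonneg _) * c i := by
  have hfc : (fun w : Fin d → ℝ => f (b.repr.symm (WithLp.toLp 2 w))) =
      (fun w => b.repr.symm (WithLp.toLp 2 w)) ∘ fun w i => l i * w i := by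
    funext w
    apply b.repr.injective
    ext i
    simp [hf]
  have hfm : Measurable f := by
    have : f = fun x => b.repr.symm (WithLp.toLp 2 fun i => l i * b.repr x i) := by
      funext x
      apply b.repr.injective
      ext i
      simp [hf]
    rw [this]
    fun_prop
  rw [basisGaussian, Measure.map_map hfm (measurable_repr_symm_toLp b)]
  change Measure.map (fun w : Fin d → ℝ => f (b.repr.symm (WithLp.toLp 2 w))) _ = _
  rw [hfc, ← Measure.map_map (measurable_repr_symm_toLp b) (by fun_prop),
    Measure.pi_map_pi (f := fun i w => l i * w) (fun i => by fun_prop), basisGaussian]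
  simp_rw [gaussianReal_map_const_mul, mul_zero]

lemma prod_sqrt_mul_basisGaussian_le {c c' : Fin d → NNReal} (hc : ∀ i, 0 < c i)
    (hcc : ∀ i, c i ≤ c' i) {A : Set (EuclideanSpace ℝ (Fin d))} (hA : MeasurableSet A) :
    (∏ i, √(c i / c' i)) * (basisGaussian b c).real A ≤ (basisGaussian b c').real A := by
  have h := prod_mul_measure_pi_le (fun i => gaussianReal 0 (c i))
    (fun i => gaussianReal 0 (c' i)) (fun i => ENNReal.ofReal (√(c i / c' i)))
    (fun i s => sqrt_div_mul_gaussianReal_le (hc i) (hcc i) s)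
    (measurable_repr_symm_toLp b hA)
  rw [← ENNReal.ofReal_prod_of_nonneg fun i _ => Real.sqrt_nonneg _] at h
  rw [measureReal_def, measureReal_def, basisGaussian, basisGaussian,
    Measure.map_apply (measurable_repr_symm_toLp b) hA,
    Measure.map_apply (measurable_repr_symm_toLp b) hA]
  have h' := ENNReal.toReal_mono (measure_ne_top _ _) h
  rwa [ENNReal.toReal_mul, ENNReal.toReal_ofReal
    (Finset.prod_nonneg fun i _ => Real.sqrt_nonneg _)] at h'

lemma abs_basisGaussian_sub_le {c c' : Fin d → NNReal} (hc : ∀ i, 0 < c i)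
    (hcc : ∀ i, c i ≤ c' i) {A : Set (EuclideanSpace ℝ (Fin d))} (hA : MeasurableSet A) :
    |(basisGaussian b c).real A - (basisGaussian b c').real A| ≤ 1 - ∏ i, √(c i / c' i) := by
  refine abs_real_sub_real_le_of_dominated
    (Finset.prod_le_one (fun i _ => Real.sqrt_nonneg _) fun i _ => ?_)
    (fun A hA => prod_sqrt_mul_basisGaussian_le b hc hcc hA) hA
  rw [Real.sqrt_le_one]
  exact div_le_one_of_le₀ (hcc i) (c' i).2

lemma one_sub_prod_sqrt_le {x : Fin d → ℝ} {ε : ℝ} (hε : 0 ≤ ε) (hε1 : ε ≤ 1)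
    (hx : ∀ i, 1 - ε ≤ x i) : 1 - ∏ i, √(x i) ≤ d * ε := by
  have h1 : (1 - ε) ^ d ≤ ∏ i, √(x i) := by
    calc (1 - ε) ^ d = ∏ _i : Fin d, (1 - ε) := by simp
      _ ≤ ∏ i, √(x i) := by
        refine Finset.prod_le_prod (fun i _ => by linarith) fun i _ => ?_
        refine Real.le_sqrt_of_sq_le ?_
        have := hx i
        nlinarith
  have h2 : 1 + (d : ℝ) * (-ε) ≤ (1 + -ε) ^ d :=
    one_add_mul_le_pow (by linarith) d
  rw [← sub_eq_add_neg] at h2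
  linarith

/-- If all variance ratios are within `ε` of `1`, the total variation is at most `2 d ε`. -/
lemma tvDist_basisGaussian_le {c c' : Fin d → NNReal} (hc : ∀ i, 0 < c i) (hc' : ∀ i, 0 < c' i)
    {ε : ℝ} (hε : 0 ≤ ε) (h : ∀ i, |(c i : ℝ) / c' i - 1| ≤ ε) :
    tvDist (basisGaussian b c) (basisGaussian b c') ≤ 2 * d * ε := by
  refine tvDist_le_of_forall fun A hA => ?_
  -- The variances need not be ordered the same way in all coordinates, so both laws are compared
  -- with the Gaussian of coordinatewise maximal variances.
  let e : Fin d → NNReal := fun i => max (c i) (c' i)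
  have hce : ∀ i, c i ≤ e i := fun i => le_max_left _ _
  have hce' : ∀ i, c' i ≤ e i := fun i => le_max_right _ _
  have h1 := abs_basisGaussian_sub_le b hc hce hA
  have h2 := abs_basisGaussian_sub_le b hc' hce' hA
  have hsplit : |(basisGaussian b c).real A - (basisGaussian b c').real A| ≤
      (1 - ∏ i, √(c i / e i)) + (1 - ∏ i, √(c' i / e i)) := by
    rw [abs_le] at *
    constructor <;> linarith [h1.1, h1.2, h2.1, h2.2]
  by_cases hd : d = 0
  · subst hd
    simpa using hsplit
  have hd1 : (1 : ℝ) ≤ d := by exact_mod_cast Nat.one_le_iff_ne_zero.mpr hd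
  by_cases hε1 : ε ≤ 1
  · have hr : ∀ i, 1 - ε ≤ (c i : ℝ) / e i := fun i => by
      have hi := (abs_le.1 (h i)).1
      rcases le_total (c i) (c' i) with hle | hle
      · simp only [e, max_eq_right hle]; linarith
      · have : (0 : ℝ) < c i := hc i
        simp only [e, max_eq_left hle]; rw [div_self this.ne']; linarith
    have hr' : ∀ i, 1 - ε ≤ (c' i : ℝ) / e i := fun i => by
      have hi := (abs_le.1 (h i)).2
      have h0' : (0 : ℝ) < c' i := hc' i
      rcases le_total (c i) (c' i) with hle | hle
      · simp only [e, max_eq_right hle]; rw [div_self h0'.ne']; linarith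
      · have h0 : (0 : ℝ) < c i := hc i
        simp only [e, max_eq_left hle]
        rw [le_div_iff₀ h0]
        have h3 : (c i : ℝ) ≤ (1 + ε) * c' i := by
          rw [← div_le_iff₀ h0']; linarith
        have : (c' i : ℝ) ≤ c i := hle
        nlinarith
    have := one_sub_prod_sqrt_le hε hε1 hr
    have := one_sub_prod_sqrt_le hε hε1 hr'
    linarith
  -- For `ε > 1` and `d ≥ 1` the claimed bound exceeds 2 and is trivial.
  · have hp : ∀ x : Fin d → NNReal, 0 ≤ ∏ i, √((x i : ℝ) / e i) := fun x =>
      Finset.prod_nonneg fun i _ => Real.sqrt_nonneg _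
    have := hp c
    have := hp c'
    push Not at hε1
    nlinarith

lemma tvDist_basisGaussian_le_of_le {c c' : Fin d → NNReal} (hc : ∀ i, 0 < c i)
    (hcc : ∀ i, c i ≤ c' i) :
    tvDist (basisGaussian b c) (basisGaussian b c') ≤ 1 - ∏ i, √((c i : ℝ) / c' i) :=
  tvDist_le_of_forall fun _ hA => abs_basisGaussian_sub_le b hc hcc hA

lemma tvDist_comm {Ω : Type*} [MeasurableSpace Ω] (P Q : Measure Ω) :
    tvDist P Q = tvDist Q P := by
  simp_rw [tvDist, abs_sub_comm]

end BasisGaussian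

/-! ### The proximal of a one-dimensional Gaussian. -/

section OneDimensional

lemma integral_exp_neg_mul_sub_sq (B w : ℝ) :
    ∫ z, Real.exp (-B * (z - w) ^ 2) = √(Real.pi / B) := by
  rw [integral_sub_right_eq_self (fun z => Real.exp (-B * z ^ 2)) w, integral_gaussian]

/-- The one-dimensional kernel is a Gaussian density in its first variable. -/
lemma kernel_real_eq {a β T : ℝ} (ha : 0 < a) (hβ : 0 < β) (hT : 0 < T) (x w : ℝ) :
    Real.exp (-(1 / (2 * β)) * (1 / 2 * (a * x ^ 2) + (x - w) ^ 2 / (2 * T))) /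
      ∫ z, Real.exp (-(1 / (2 * β)) * (1 / 2 * (a * z ^ 2) + (z - w) ^ 2 / (2 * T))) =
    (√(Real.pi / ((1 + T * a) / (4 * β * T))))⁻¹ *
      Real.exp (-((1 + T * a) / (4 * β * T)) * (x - w / (1 + T * a)) ^ 2) := by
  have h1 : 0 < 1 + T * a := by positivity
  -- Completing the square in `z` leaves a factor depending only on `w`, which cancels against the
  -- normalizing integral.
  have hsplit : ∀ z : ℝ,
      Real.exp (-(1 / (2 * β)) * (1 / 2 * (a * z ^ 2) + (z - w) ^ 2 / (2 * T))) =
      Real.exp (-((1 + T * a) / (4 * β * T)) * (z - w / (1 + T * a)) ^ 2) *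
        Real.exp (-(1 / (4 * β)) * (a / (1 + T * a)) * w ^ 2) := by
    intro z
    rw [← Real.exp_add]
    congr 1
    field_simp
    ring
  simp_rw [hsplit]
  rw [integral_mul_const, integral_exp_neg_mul_sub_sq,
    mul_div_mul_right _ _ (Real.exp_pos _).ne', div_eq_inv_mul]

/-- A Gaussian convolution: variances $m^2c$ and $1/(2B)$ add. The value of `K` is irrelevant, since
the gradient of the logarithm removes it. -/
lemma integral_exp_gaussianReal {B m : ℝ} (hB : 0 < B) {c : NNReal} (hc : 0 < c) :
    ∃ K : ℝ, 0 < K ∧ ∀ x : ℝ,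
      ∫ w, Real.exp (-B * (x - m * w) ^ 2) ∂gaussianReal 0 c =
        K * Real.exp (-(x ^ 2 / (2 * (m ^ 2 * c + 1 / (2 * B))))) := by
  have hcR : (0 : ℝ) < c := hc
  set P : ℝ := 1 / (2 * c) + B * m ^ 2 with hP
  have hPpos : 0 < P := by positivity
  refine ⟨(√(2 * Real.pi * c))⁻¹ * √(Real.pi / P), by positivity, fun x => ?_⟩
  rw [integral_gaussianReal_eq_integral_smul hc.ne']
  have hsplit : ∀ w : ℝ, gaussianPDFReal 0 c w • Real.exp (-B * (x - m * w) ^ 2) =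
      (√(2 * Real.pi * c))⁻¹ * Real.exp (-(x ^ 2 / (2 * (m ^ 2 * c + 1 / (2 * B))))) *
        Real.exp (-P * (w - B * m * x / P) ^ 2) := by
    intro w
    rw [gaussianPDFReal, smul_eq_mul, mul_assoc _ (Real.exp _), mul_assoc _ (Real.exp _),
      ← Real.exp_add, ← Real.exp_add]
    congr 2
    have hD : 0 < m ^ 2 * c * (2 * B) + 1 := by positivity
    have hP' : P = (m ^ 2 * c * (2 * B) + 1) / (2 * c) := by rw [hP]; field_simp; ring
    have hS : m ^ 2 * c + 1 / (2 * B) = (m ^ 2 * c * (2 * B) + 1) / (2 * B) := by field_simp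
    rw [hP', hS]
    field_simp
    ring
  simp_rw [hsplit]
  rw [integral_const_mul, integral_exp_neg_mul_sub_sq]
  ring

lemma prox_real_eq {a β T : ℝ} (ha : 0 < a) (hβ : 0 < β) (hT : 0 < T) {c : NNReal} (hc : 0 < c) :
    ∃ K : ℝ, 0 < K ∧ ∀ x : ℝ,
      ∫ w, Real.exp (-(1 / (2 * β)) * (1 / 2 * (a * x ^ 2) + (x - w) ^ 2 / (2 * T))) /
        (∫ z, Real.exp (-(1 / (2 * β)) * (1 / 2 * (a * z ^ 2) + (z - w) ^ 2 / (2 * T))))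
        ∂gaussianReal 0 c =
      K * Real.exp (-(x ^ 2 / (2 * (c / (1 + T * a) ^ 2 + 2 * β * T / (1 + T * a))))) := by
  have h1 : 0 < 1 + T * a := by positivity
  obtain ⟨K, hK, h⟩ := integral_exp_gaussianReal (B := (1 + T * a) / (4 * β * T))
    (m := (1 + T * a)⁻¹) (by positivity) hc
  refine ⟨(√(Real.pi / ((1 + T * a) / (4 * β * T))))⁻¹ * K, by positivity, fun x => ?_⟩
  simp_rw [kernel_real_eq ha hβ hT]
  rw [integral_const_mul, mul_assoc _ K]
  have h2 : (1 + T * a)⁻¹ ^ 2 * c + 1 / (2 * ((1 + T * a) / (4 * β * T))) =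
      c / (1 + T * a) ^ 2 + 2 * β * T / (1 + T * a) := by
    field_simp
    ring
  rw [← h2, ← h]
  simp_rw [div_eq_inv_mul _ (1 + T * a)]

end OneDimensional

/-! ### The proximal density and one step of the scheme in an eigenbasis. -/

section Prox

variable {d : ℕ} (b : OrthonormalBasis (Fin d) ℝ (EuclideanSpace ℝ (Fin d)))

lemma integral_eq_integral_repr_symm (g : EuclideanSpace ℝ (Fin d) → ℝ) :
    ∫ z, g z = ∫ w : Fin d → ℝ, g (b.repr.symm (WithLp.toLp 2 w)) := by
  rw [← b.measurePreserving_repr_symm.integral_comp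
      b.repr.symm.toHomeomorph.measurableEmbedding,
    ← (PiLp.volume_preserving_toLp (Fin d)).integral_comp
      (MeasurableEquiv.toLp 2 (Fin d → ℝ)).measurableEmbedding]

lemma exponent_repr_eq {a : Fin d → ℝ} {β T : ℝ} {V : EuclideanSpace ℝ (Fin d) → ℝ}
    (hV : ∀ x, V x = 1 / 2 * ∑ i, a i * (b.repr x i) ^ 2) (x : EuclideanSpace ℝ (Fin d))
    (w : Fin d → ℝ) :
    Real.exp (-(1 / (2 * β)) *
        (V x + ‖x - b.repr.symm (WithLp.toLp 2 w)‖ ^ 2 / (2 * T))) =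
      ∏ i, Real.exp (-(1 / (2 * β)) *
        (1 / 2 * (a i * (b.repr x i) ^ 2) + (b.repr x i - w i) ^ 2 / (2 * T))) := by
  rw [← Real.exp_sum, ← Finset.mul_sum, Finset.sum_add_distrib, ← Finset.sum_div,
    ← Finset.mul_sum, hV, ← b.repr.norm_map (x - _), EuclideanSpace.real_norm_sq_eq]
  simp

lemma kernel_repr_eq {a : Fin d → ℝ} {β T : ℝ} {V : EuclideanSpace ℝ (Fin d) → ℝ}
    (hV : ∀ x, V x = 1 / 2 * ∑ i, a i * (b.repr x i) ^ 2) (x : EuclideanSpace ℝ (Fin d))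
    (w : Fin d → ℝ) :
    kernel V β T x (b.repr.symm (WithLp.toLp 2 w)) =
      ∏ i, Real.exp (-(1 / (2 * β)) *
          (1 / 2 * (a i * (b.repr x i) ^ 2) + (b.repr x i - w i) ^ 2 / (2 * T))) /
        ∫ z, Real.exp (-(1 / (2 * β)) *
          (1 / 2 * (a i * z ^ 2) + (z - w i) ^ 2 / (2 * T))) := by
  rw [kernel, integral_eq_integral_repr_symm b, Finset.prod_div_distrib]
  simp_rw [exponent_repr_eq b hV]
  congr 1
  rw [← integral_fintype_prod_volume_eq_prod]
  simp

/-- The regularized proximal of a Gaussian is proportional to a Gaussian density. -/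
lemma proxDensity_basisGaussian {a : Fin d → ℝ} (ha : ∀ i, 0 < a i) {β T : ℝ} (hβ : 0 < β)
    (hT : 0 < T) {V : EuclideanSpace ℝ (Fin d) → ℝ}
    (hV : ∀ x, V x = 1 / 2 * ∑ i, a i * (b.repr x i) ^ 2) {c : Fin d → NNReal}
    (hc : ∀ i, 0 < c i) :
    ∃ K : ℝ, 0 < K ∧ ∀ x, proxDensity V β T (basisGaussian b c) x =
      K * Real.exp (-(1 / 2 * ∑ i,
        (c i / (1 + T * a i) ^ 2 + 2 * β * T / (1 + T * a i))⁻¹ * (b.repr x i) ^ 2)) := by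
  choose K hK h using fun i => prox_real_eq (ha i) hβ hT (hc i)
  refine ⟨∏ i, K i, Finset.prod_pos fun i _ => hK i, fun x => ?_⟩
  have hemb : MeasurableEmbedding fun w : Fin d → ℝ => b.repr.symm (WithLp.toLp 2 w) :=
    b.repr.symm.toHomeomorph.measurableEmbedding.comp
      (MeasurableEquiv.toLp 2 (Fin d → ℝ)).measurableEmbedding
  rw [proxDensity, basisGaussian, hemb.integral_map]
  simp_rw [kernel_repr_eq b hV]
  rw [integral_fintype_prod_eq_prod (fun i w => Real.exp (-(1 / (2 * β)) *
          (1 / 2 * (a i * (b.repr x i) ^ 2) + (b.repr x i - w) ^ 2 / (2 * T))) /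
        ∫ z, Real.exp (-(1 / (2 * β)) *
          (1 / 2 * (a i * z ^ 2) + (z - w) ^ 2 / (2 * T))))]
  simp_rw [h]
  rw [Finset.prod_mul_distrib, ← Real.exp_sum, Finset.sum_neg_distrib, Finset.mul_sum]
  congr 3
  refine Finset.sum_congr rfl fun i _ => ?_
  rw [div_eq_mul_inv, mul_inv]
  ring

lemma hasGradientAt_quadratic (k : ℝ) (q : Fin d → ℝ) (x : EuclideanSpace ℝ (Fin d)) :
    HasGradientAt (fun u => k + 1 / 2 * ∑ i, q i * (b.repr u i) ^ 2)
      (∑ i, (q i * b.repr x i) • b i) x := by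
  rw [hasGradientAt_iff_hasFDerivAt]
  have hi : ∀ i, HasFDerivAt (fun u : EuclideanSpace ℝ (Fin d) => b.repr u i)
      (innerSL ℝ (b i)) x := fun i => by
    have := (innerSL ℝ (b i)).hasFDerivAt (x := x)
    refine this.congr_of_eventuallyEq (Eventually.of_forall fun u => ?_)
    simp [b.repr_apply_apply]
  have hs := ((HasFDerivAt.fun_sum (u := Finset.univ) fun i _ =>
    ((hi i).pow 2).const_mul (q i)).const_mul (1 / 2 : ℝ)).const_add k
  refine hs.congr_fderiv ?_
  ext y
  simp [Finset.mul_sum]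
  refine Finset.sum_congr rfl fun i _ => ?_
  ring

lemma repr_sum_smul (q : Fin d → ℝ) (i : Fin d) : b.repr (∑ j, q j • b j) i = q i := by
  rw [b.repr_apply_apply, b.orthonormal.inner_right_fintype]

lemma repr_update_basisGaussian {a : Fin d → ℝ} (ha : ∀ i, 0 < a i) {β T : ℝ} (hβ : 0 < β)
    (hT : 0 < T) (η : ℝ) {V : EuclideanSpace ℝ (Fin d) → ℝ}
    (hV : ∀ x, V x = 1 / 2 * ∑ i, a i * (b.repr x i) ^ 2) {c : Fin d → NNReal}
    (hc : ∀ i, 0 < c i) (x : EuclideanSpace ℝ (Fin d)) (i : Fin d) :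
    b.repr (update V β T η (basisGaussian b c) x) i =
      (1 - η * a i + η * β * (c i / (1 + T * a i) ^ 2 + 2 * β * T / (1 + T * a i))⁻¹) *
        b.repr x i := by
  obtain ⟨K, hK, h⟩ := proxDensity_basisGaussian b ha hβ hT hV hc
  have hg1 : gradient V x = ∑ i, (a i * b.repr x i) • b i := by
    have hV' : V = fun u => 0 + 1 / 2 * ∑ i, a i * (b.repr u i) ^ 2 := by
      funext u; rw [hV, zero_add]
    rw [hV']
    exact (hasGradientAt_quadratic b 0 a x).gradient
  have hg2 : gradient (fun u => Real.log (proxDensity V β T (basisGaussian b c) u)) x =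
      ∑ i, (-(c i / (1 + T * a i) ^ 2 + 2 * β * T / (1 + T * a i))⁻¹ * b.repr x i) • b i := by
    have hl : (fun u => Real.log (proxDensity V β T (basisGaussian b c) u)) =
        fun u => Real.log K + 1 / 2 * ∑ i,
          -(c i / (1 + T * a i) ^ 2 + 2 * β * T / (1 + T * a i))⁻¹ * (b.repr u i) ^ 2 := by
      funext u
      rw [h, Real.log_mul hK.ne' (Real.exp_pos _).ne', Real.log_exp]
      simp_rw [neg_mul, Finset.sum_neg_distrib, mul_neg]
    rw [hl]
    exact (hasGradientAt_quadratic b _ _ x).gradient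
  rw [update, hg1, hg2, map_sub, map_sub, map_smul, map_smul]
  simp only [PiLp.sub_apply, PiLp.smul_apply, repr_sum_smul, smul_eq_mul]
  ring

/-- One step of the scheme maps centred Gaussians diagonal in an eigenbasis of the potential to
such Gaussians. -/
lemma step_basisGaussian {a : Fin d → ℝ} (ha : ∀ i, 0 < a i) {β T : ℝ} (hβ : 0 < β)
    (hT : 0 < T) (η : ℝ) {V : EuclideanSpace ℝ (Fin d) → ℝ}
    (hV : ∀ x, V x = 1 / 2 * ∑ i, a i * (b.repr x i) ^ 2) {c : Fin d → NNReal}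
    (hc : ∀ i, 0 < c i) :
    step V β T η (basisGaussian b c) = basisGaussian b fun i => .mk
      ((1 - η * a i + η * β * (c i / (1 + T * a i) ^ 2 + 2 * β * T / (1 + T * a i))⁻¹) ^ 2)
        (sq_nonneg _) * c i :=
  map_basisGaussian b c _ _ (repr_update_basisGaussian b ha hβ hT η hV hc)

end Prox

/-! ### The scalar variance recursion. -/

section Scalar

/-- The step size bound makes a discriminant nonpositive. -/
lemma discriminant_bound {t h u z : ℝ} (ht : 0 < t) (hh1 : h < 1)
    (hth : h ^ 2 * (1 - t) ≤ 8 * t * (1 - h)) (hz : z ^ 2 = 1 - t ^ 2) :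
    h * u * (u + z) ≤ u ^ 2 + 2 * t * (1 + t) := by
  have h4 : (h * z) ^ 2 ≤ 4 * (1 - h) * (2 * t * (1 + t)) := by
    calc (h * z) ^ 2 = h ^ 2 * (1 - t) * (1 + t) := by rw [mul_pow, hz]; ring
      _ ≤ 8 * t * (1 - h) * (1 + t) := by gcongr
      _ = 4 * (1 - h) * (2 * t * (1 + t)) := by ring
  -- The claim is nonnegativity of a quadratic in `u` with leading coefficient `1 - h`; multiplying
  -- by `4 * (1 - h)` completes the square, and `h4` is the discriminant condition.
  have h5 : 0 ≤ 4 * (1 - h) * ((1 - h) * u ^ 2 - h * z * u + 2 * t * (1 + t)) := by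
    have h6 : 4 * (1 - h) * ((1 - h) * u ^ 2 - h * z * u + 2 * t * (1 + t)) =
        (2 * (1 - h) * u - h * z) ^ 2 + (4 * (1 - h) * (2 * t * (1 + t)) - (h * z) ^ 2) := by ring
    rw [h6]
    exact add_nonneg (sq_nonneg _) (sub_nonneg.2 h4)
  have h6 := nonneg_of_mul_nonneg_right h5 (by linarith)
  linarith

/-- The recursion for normalized variances contracts towards its fixed point `1 - t ^ 2`. -/
lemma normalized_variance_step {t h p v : ℝ} (ht : 0 < t) (ht3 : t ≤ 1 / 3) (hh : 0 < h)
    (hh1 : h < 1) (hth : h ^ 2 * (1 - t) ≤ 8 * t * (1 - h)) (hp : 0 < p) (hp2 : p ≤ 1 / 2)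
    (hv : 0 < v) (hpv : p * (v + 2 * t * (1 + t)) ≤ v) {f : ℝ}
    (hf : f = (1 - h + h * (1 + t) ^ 2 / (v + 2 * t * (1 + t))) ^ 2 * v) :
    0 < f ∧ p * (f + 2 * t * (1 + t)) ≤ f ∧
      |f - (1 - t ^ 2)| ≤ (1 - h * p) * |v - (1 - t ^ 2)| := by
  set q := 2 * t * (1 + t) with hq
  set w := 1 - t ^ 2 with hw
  have hq0 : 0 < q := by positivity
  have hw0 : 0 < w := by rw [hw]; nlinarith
  have hs0 : 0 < v + q := by positivity
  have hwq : (1 + t) ^ 2 = w + q := by rw [hw, hq]; ring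
  set g := 1 - h + h * (1 + t) ^ 2 / (v + q) with hg
  have hg0 : 0 < g := by
    have : 0 < h * (1 + t) ^ 2 / (v + q) := by positivity
    linarith
  have hg' : g = 1 + h * (w - v) / (v + q) := by
    rw [hg, hwq]; field_simp; ring
  have hgs : g * (v + q) = v + q + h * (w - v) := by
    rw [hg']; field_simp
  have hpvs : p ≤ v / (v + q) := (le_div_iff₀ hs0).2 hpv
  -- Here $w/(w+q)=(1-t)/(1+t)\ge 1/2$ because $t\le 1/3$.
  have hpw : p * (w + q) ≤ w := by
    have h1 : p * (1 + t) ^ 2 ≤ 1 / 2 * (1 + t) ^ 2 := by gcongr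
    rw [← hwq, hw]
    nlinarith
  set u := √v
  set z := √w
  have hu0 : 0 < u := Real.sqrt_pos.2 hv
  have hz0 : 0 < z := Real.sqrt_pos.2 hw0
  have hu2 : u ^ 2 = v := Real.sq_sqrt hv.le
  have hz2 : z ^ 2 = w := Real.sq_sqrt hw0.le
  have hfu : f = (g * u) ^ 2 := by rw [hf, mul_pow, hu2]
  have hdisc : h * u * (u + z) ≤ v + q := by
    rw [← hu2]
    exact discriminant_bound ht hh1 hth hz2
  -- On standard deviations, the last factor decides overshooting: it is nonnegative by `hdisc`, so
  -- `g * u` stays on the same side of `z` as `u`.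
  have hsign : (z - g * u) * (v + q) = (z - u) * (v + q - h * u * (u + z)) := by
    have h1 : g * u * (v + q) = u * (v + q + h * (w - v)) := by rw [← hgs]; ring
    have h2 : w - v = (z - u) * (u + z) := by rw [← hu2, ← hz2]; ring
    rw [sub_mul, h1, h2]; ring
  have hf0 : 0 < f := by rw [hfu]; positivity
  -- The condition is monotone in `y` as `p ≤ 1`. Since `f` lies between `v` and `w`, it is
  -- inherited from whichever is smaller.
  have hkeep : ∀ {y : ℝ}, y ≤ f → p * (y + q) ≤ y → p * (f + q) ≤ f := fun {y} hyf hy => by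
    have := mul_le_mul_of_nonneg_left hyf (by linarith : 0 ≤ 1 - p)
    linarith
  rcases le_total v w with hvw | hvw
  · have huz : u ≤ z := Real.sqrt_le_sqrt hvw
    have hgu : g * u ≤ z := by
      have : 0 ≤ (z - g * u) * (v + q) := by
        rw [hsign]; exact mul_nonneg (by linarith) (by linarith)
      linarith [nonneg_of_mul_nonneg_left this hs0]
    have hfw : f ≤ w := by
      rw [hfu, ← hz2]; gcongr
    have hfv : v + h * p * (w - v) ≤ f := by
      -- Below the fixed point `g ≥ 1`, so one factor of `g` can be dropped; above it `g ≤ 1` and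
      -- the inequality is reversed.
      have h7 : 1 + h * (w - v) / (v + q) ≤ g ^ 2 := by
        have h8 : 0 ≤ h * (w - v) / (v + q) :=
          div_nonneg (mul_nonneg hh.le (by linarith)) hs0.le
        rw [hg']
        generalize h * (w - v) / (v + q) = y at h8
        nlinarith [sq_nonneg y]
      calc v + h * p * (w - v) ≤ v + h * (v / (v + q)) * (w - v) := by
            have : 0 ≤ w - v := by linarith
            gcongr
        _ = (1 + h * (w - v) / (v + q)) * v := by ring
        _ ≤ f := by rw [hf]; gcongr
    have hfv' : v ≤ f := by
      have : 0 ≤ h * p * (w - v) := mul_nonneg (by positivity) (by linarith)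
      linarith
    refine ⟨hf0, hkeep hfv' hpv, ?_⟩
    rw [abs_of_nonpos (by linarith), abs_of_nonpos (by linarith)]
    linarith
  · have huz : z ≤ u := Real.sqrt_le_sqrt hvw
    have hgu : z ≤ g * u := by
      have : 0 ≤ (g * u - z) * (v + q) := by
        have h9 : (g * u - z) * (v + q) = (u - z) * (v + q - h * u * (u + z)) := by linarith
        rw [h9]; exact mul_nonneg (by linarith) (by linarith)
      linarith [nonneg_of_mul_nonneg_left this hs0]
    have hfw : w ≤ f := by
      rw [hfu, ← hz2]; gcongr
    have hg1 : g ≤ 1 := by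
      have : h * (w - v) / (v + q) ≤ 0 :=
        div_nonpos_of_nonpos_of_nonneg (mul_nonpos_of_nonneg_of_nonpos hh.le (by linarith)) hs0.le
      linarith
    have hfv : f ≤ v - h * p * (v - w) := by
      calc f ≤ g * v := by
            rw [hf]
            gcongr
            exact pow_le_of_le_one hg0.le hg1 two_ne_zero
        _ = v - h * (v / (v + q)) * (v - w) := by rw [hg']; ring
        _ ≤ v - h * p * (v - w) := by
            have : 0 ≤ v - w := by linarith
            gcongr
    refine ⟨hf0, hkeep hfw hpw, ?_⟩
    rw [abs_of_nonneg (by linarith), abs_of_nonneg (by linarith)]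
    linarith

/-- The variance of one coordinate after a step, for curvature `a` and current variance `c`. -/
noncomputable def nextVariance (a β T η : ℝ) (c : NNReal) : NNReal :=
  .mk ((1 - η * a + η * β * (c / (1 + T * a) ^ 2 + 2 * β * T / (1 + T * a))⁻¹) ^ 2)
    (sq_nonneg _) * c

lemma iterate_nextVariance {a β T η p : ℝ} (ha : 0 < a) (hβ : 0 < β) (hT : 0 < T) (hη : 0 < η)
    (ht3 : T * a ≤ 1 / 3) (hh1 : η * a < 1)
    (hth : (η * a) ^ 2 * (1 - T * a) ≤ 8 * (T * a) * (1 - η * a)) (hp : 0 < p) (hp2 : p ≤ 1 / 2)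
    {c : NNReal} (hc : 0 < c)
    (hpc : p * (a * c / β + 2 * (T * a) * (1 + T * a)) ≤ a * c / β) (k : ℕ) :
    0 < (nextVariance a β T η)^[k] c ∧
      p * (a * ((nextVariance a β T η)^[k] c) / β + 2 * (T * a) * (1 + T * a)) ≤
        a * ((nextVariance a β T η)^[k] c) / β ∧
      |a * ((nextVariance a β T η)^[k] c) / β - (1 - (T * a) ^ 2)| ≤
        (1 - η * a * p) ^ k * |a * c / β - (1 - (T * a) ^ 2)| := by
  induction k with
  | zero => simpa using ⟨hc, hpc⟩
  | succ k ih =>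
    obtain ⟨ih1, ih2, ih3⟩ := ih
    rw [Function.iterate_succ_apply']
    set e := (nextVariance a β T η)^[k] c
    have he : (0 : ℝ) < e := ih1
    -- In the variable $ac/\beta$ the temperature $\beta$ disappears from the recursion.
    have hf : a * (nextVariance a β T η e : ℝ) / β = (1 - η * a + η * a * (1 + T * a) ^ 2 /
        (a * e / β + 2 * (T * a) * (1 + T * a))) ^ 2 * (a * e / β) := by
      have hinv : β * ((e : ℝ) / (1 + T * a) ^ 2 + 2 * β * T / (1 + T * a))⁻¹ =
          a * (1 + T * a) ^ 2 / (a * e / β + 2 * (T * a) * (1 + T * a)) := by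
        have h1 : 0 < 1 + T * a := by positivity
        field_simp
      rw [nextVariance, NNReal.coe_mul, NNReal.coe_mk, mul_assoc η β, hinv]
      ring
    obtain ⟨h1, h2, h3⟩ := normalized_variance_step (by positivity) ht3 (by positivity) hh1 hth
      hp hp2 (by positivity) ih2 hf
    refine ⟨?_, h2, h3.trans ?_⟩
    · have : 0 < (nextVariance a β T η e : ℝ) := by
        rw [div_pos_iff_of_pos_right hβ] at h1
        exact pos_of_mul_pos_right h1 ha.le
      exact this
    · have : 0 ≤ 1 - η * a * p := by nlinarith [mul_pos hη ha]
      rw [pow_succ' (1 - η * a * p), mul_assoc (1 - η * a * p)]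
      gcongr

/-- With $s=\sqrt{(\xi+T)/(2T)}$ the bound reads $xs\le 2-x$. Squaring gives $x^2(s^2-1)\le 4(1-x)$,
and $2t(s^2-1)=1-t$ turns this into the discriminant condition. -/
lemma step_size_condition {ξ T η : ℝ} (hξ : 0 < ξ) (hT : 0 < T) (hη : 0 < η) (h3 : T * ξ⁻¹ ≤ 1 / 3)
    (h : η * ξ⁻¹ ≤ 1 / stepDelta ξ T) :
    η * ξ⁻¹ < 1 ∧ (η * ξ⁻¹) ^ 2 * (1 - T * ξ⁻¹) ≤ 8 * (T * ξ⁻¹) * (1 - η * ξ⁻¹) := by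
  set x := η * ξ⁻¹
  set t := T * ξ⁻¹ with ht
  have ht0 : 0 < t := by positivity
  have hx0 : 0 < x := by positivity
  set s := √((ξ + T) / (2 * T)) with hs
  have hs2 : 2 * t * s ^ 2 = 1 + t := by
    rw [hs, Real.sq_sqrt (by positivity), ht]
    field_simp
  have hs0 : 0 ≤ s := Real.sqrt_nonneg _
  have hs1 : 1 < s := by nlinarith
  have hxs : x * (s + 1) ≤ 2 := by
    rw [stepDelta, ← hs, le_div_iff₀ (by linarith)] at h
    linarith
  have hx1 : x < 1 := by nlinarith
  refine ⟨hx1, ?_⟩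
  have h1 : (x * s) ^ 2 ≤ (2 - x) ^ 2 := by
    gcongr; linarith
  have h2 : 1 - t = 2 * t * (s ^ 2 - 1) := by linarith
  rw [h2]
  nlinarith

end Scalar

/-! ### Spectral data of `S`, and the initial and stationary laws in its eigenbasis. -/

section Spectral

variable {d : ℕ} (b : OrthonormalBasis (Fin d) ℝ (EuclideanSpace ℝ (Fin d)))

lemma dotProduct_mulVec_eq_sum_of_eigenbasis {M : Matrix (Fin d) (Fin d) ℝ} {μ : Fin d → ℝ}
    (h : ∀ i, M *ᵥ WithLp.ofLp (b i) = μ i • WithLp.ofLp (b i)) (x : EuclideanSpace ℝ (Fin d)) :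
    WithLp.ofLp x ⬝ᵥ M *ᵥ WithLp.ofLp x = ∑ i, μ i * (b.repr x i) ^ 2 := by
  have hx : WithLp.ofLp x = ∑ i, b.repr x i • WithLp.ofLp (b i) := by
    conv_lhs => rw [← b.sum_repr x]
    simp
  have hM : M *ᵥ WithLp.ofLp x = ∑ i, (μ i * b.repr x i) • WithLp.ofLp (b i) := by
    conv_lhs => rw [hx]
    rw [Matrix.mulVec_sum]
    refine Finset.sum_congr rfl fun i _ => ?_
    rw [Matrix.mulVec_smul, h, smul_smul, mul_comm]
  rw [hM, dotProduct_sum]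
  refine Finset.sum_congr rfl fun i _ => ?_
  have : WithLp.ofLp x ⬝ᵥ WithLp.ofLp (b i) = b.repr x i := by
    rw [b.repr_apply_apply, EuclideanSpace.inner_eq_star_dotProduct]
    simp
  rw [dotProduct_smul, this, smul_eq_mul]
  ring

lemma multivariateGaussian_eq_of_eigenbasis {M : Matrix (Fin d) (Fin d) ℝ} (hM : M.IsHermitian)
    (c : Fin d → NNReal)
    (h : ∀ i, M *ᵥ WithLp.ofLp (b i) = (c i : ℝ) • WithLp.ofLp (b i)) :
    multivariateGaussian 0 M = basisGaussian b c := by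
  have hq := dotProduct_mulVec_eq_sum_of_eigenbasis b h
  refine multivariateGaussian_eq_basisGaussian b ?_ c hq
  refine Matrix.PosSemidef.of_dotProduct_mulVec_nonneg hM fun x => ?_
  have := hq (WithLp.toLp 2 x)
  simp only [star_trivial] at this ⊢
  rw [this]
  positivity

variable {S : Matrix (Fin d) (Fin d) ℝ}

lemma inv_mulVec_eigenvectorBasis (hS : S.PosDef) (i : Fin d) :
    S⁻¹ *ᵥ WithLp.ofLp (hS.isHermitian.eigenvectorBasis i) =
      (hS.isHermitian.eigenvalues i)⁻¹ • WithLp.ofLp (hS.isHermitian.eigenvectorBasis i) := by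
  have h := hS.isHermitian.mulVec_eigenvectorBasis i
  have h0 : hS.isHermitian.eigenvalues i ≠ 0 := (hS.eigenvalues_pos i).ne'
  have hu : IsUnit S.det := (Matrix.isUnit_iff_isUnit_det S).1 hS.isUnit
  have h2 := congrArg (fun y => (hS.isHermitian.eigenvalues i)⁻¹ • (S⁻¹ *ᵥ y)) h
  simp only [Matrix.mulVec_mulVec, Matrix.nonsing_inv_mul S hu, Matrix.one_mulVec,
    Matrix.mulVec_smul, smul_smul, inv_mul_cancel₀ h0, one_smul] at h2
  exact h2.symm

lemma quadPotential_eq (hS : S.PosDef) (x : EuclideanSpace ℝ (Fin d)) :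
    quadPotential S x = 1 / 2 * ∑ i, (hS.isHermitian.eigenvalues i)⁻¹ *
      (hS.isHermitian.eigenvectorBasis.repr x i) ^ 2 := by
  rw [quadPotential, dotProduct_mulVec_eq_sum_of_eigenbasis _ (inv_mulVec_eigenvectorBasis hS)]

lemma isoGaussian_eq {s : NNReal} : isoGaussian d s = basisGaussian b fun _ => s := by
  refine multivariateGaussian_eq_of_eigenbasis b ?_ _ fun i => ?_
  · exact Matrix.isHermitian_one.smul (IsSelfAdjoint.all (s : ℝ))
  · rw [Matrix.smul_mulVec, Matrix.one_mulVec]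

lemma stationary_eq (hS : S.PosDef) (β T : ℝ) (c : Fin d → NNReal)
    (hc : ∀ i, (c i : ℝ) = β * (1 - (T * (hS.isHermitian.eigenvalues i)⁻¹) ^ 2) *
      hS.isHermitian.eigenvalues i) :
    stationary S β T = basisGaussian hS.isHermitian.eigenvectorBasis c := by
  have hu : IsUnit S.det := (Matrix.isUnit_iff_isUnit_det S).1 hS.isUnit
  refine multivariateGaussian_eq_of_eigenbasis _ ?_ _ fun i => ?_
  · have h : (1 - T • S⁻¹) * S * (1 + T • S⁻¹) = S - (T ^ 2) • S⁻¹ := by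
      rw [sub_mul, one_mul, smul_mul_assoc, Matrix.nonsing_inv_mul S hu, mul_add, mul_one,
        sub_mul, mul_smul_comm, Matrix.mul_nonsing_inv S hu, mul_smul_comm, smul_mul_assoc,
        one_mul, smul_smul, ← sq]
      abel
    rw [h]
    exact (hS.isHermitian.sub (hS.isHermitian.inv.smul (IsSelfAdjoint.all _))).smul
      (IsSelfAdjoint.all _)
  · have h0 : hS.isHermitian.eigenvalues i ≠ 0 := (hS.eigenvalues_pos i).ne'
    rw [hc]
    simp only [Matrix.smul_mulVec, ← Matrix.mulVec_mulVec, Matrix.sub_mulVec, Matrix.add_mulVec,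
      Matrix.one_mulVec, inv_mulVec_eigenvectorBasis hS, Matrix.mulVec_smul, Matrix.mulVec_add,
      hS.isHermitian.mulVec_eigenvectorBasis]
    ext j
    simp only [Pi.smul_apply, Pi.sub_apply, Pi.add_apply, smul_eq_mul]
    field_simp
    ring

lemma mem_spectrum_iff_exists_eigenvalue (hS : S.PosDef) (x : ℝ) :
    x ∈ spectrum ℝ S ↔ ∃ i, x = hS.isHermitian.eigenvalues i := by
  rw [hS.isHermitian.spectrum_real_eq_range_eigenvalues, Set.mem_range]
  simp_rw [eq_comm]

lemma mem_spectrum_inv_iff_exists_eigenvalue (hS : S.PosDef) (x : ℝ) :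
    x ∈ spectrum ℝ S⁻¹ ↔ ∃ i, x = (hS.isHermitian.eigenvalues i)⁻¹ := by
  obtain ⟨u, hu⟩ := hS.isUnit
  have h : spectrum ℝ S⁻¹ = (spectrum ℝ S)⁻¹ := by
    rw [← hu, ← Matrix.coe_units_inv, spectrum.map_inv]
  rw [h, Set.mem_inv, mem_spectrum_iff_exists_eigenvalue hS]
  simp_rw [inv_eq_iff_eq_inv]

end Spectral

/-! ### From geometric decay to mixing times. -/

section Mixing

lemma law_basisGaussian {d : ℕ} (b : OrthonormalBasis (Fin d) ℝ (EuclideanSpace ℝ (Fin d)))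
    {a : Fin d → ℝ} (ha : ∀ i, 0 < a i) {β T : ℝ} (hβ : 0 < β)
    (hT : 0 < T) (η : ℝ) {V : EuclideanSpace ℝ (Fin d) → ℝ}
    (hV : ∀ x, V x = 1 / 2 * ∑ i, a i * (b.repr x i) ^ 2) {c : Fin d → NNReal}
    (hc : ∀ k i, 0 < (nextVariance (a i) β T η)^[k] (c i)) (k : ℕ) :
    law V β T η (basisGaussian b c) k =
      basisGaussian b fun i => (nextVariance (a i) β T η)^[k] (c i) := by
  induction k with
  | zero => rfl
  | succ k ih =>
    rw [law] at ih ⊢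
    rw [Function.iterate_succ_apply', ih, step_basisGaussian b ha hβ hT η hV (hc k)]
    simp_rw [Function.iterate_succ_apply', nextVariance]

lemma exists_isMixingTime_le {Ω : Type*} [MeasurableSpace Ω] {P : ℕ → Measure Ω} {Q : Measure Ω}
    {δ : ℝ} {k : ℕ} (hk : tvDist (P k) Q ≤ δ) : ∃ t, IsMixingTime P Q δ t ∧ t ≤ k := by
  classical
  have h : ∃ k, tvDist (P k) Q ≤ δ := ⟨k, hk⟩
  exact ⟨Nat.find h, ⟨Nat.find_spec h, fun _ hj => Nat.find_min' h hj⟩, Nat.find_min' h hk⟩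

lemma tendsto_and_exists_isMixingTime {Ω : Type*} [MeasurableSpace Ω] {P : ℕ → Measure Ω}
    {Q : Measure Ω} {A D p κ r : ℝ} (hA : 1 ≤ A) (hD : 1 ≤ D) (hp : 0 < p) (hp1 : p ≤ 1)
    (hκ : 1 ≤ κ) (hr : 0 < r) (hr4 : r ≤ 1 / 4)
    (hbound : ∀ k, tvDist (P k) Q ≤ A * D * (1 - p / κ) ^ k)
    (hzero : D < 2 → tvDist (P 0) Q ≤ 1 - r) :
    Tendsto (fun k => tvDist (P k) Q) atTop (𝓝 0) ∧
    ∀ δ : ℝ, 0 < δ → δ < 1 → ∃ t : ℕ, IsMixingTime P Q δ t ∧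
      (t : ℝ) ≤ ((Real.log A / r + 2) / p + 1 / r) *
        (κ ^ (3 / 2 : ℝ) * Real.log (κ * √D / δ)) := by
  have hκ0 : 0 < κ := by linarith
  have hlogA : 0 ≤ Real.log A := Real.log_nonneg hA
  have hpκ : p / κ ≤ 1 := div_le_one_of_le₀ (by linarith) hκ0.le
  have hpκ0 : 0 < p / κ := by positivity
  refine ⟨?_, fun δ hδ hδ1 => ?_⟩
  · have h := (tendsto_pow_atTop_nhds_zero_of_lt_one (r := 1 - p / κ) (by linarith)
      (by linarith)).const_mul (A * D)
    rw [mul_zero] at h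
    exact squeeze_zero (fun k => tvDist_nonneg _ _) hbound h
  have hsD : 1 ≤ √D := Real.one_le_sqrt.2 hD
  have hκD : 1 ≤ κ * √D := by nlinarith
  have hδi : 1 ≤ 1 / δ := by rw [le_div_iff₀ hδ]; linarith
  have harg : 1 / δ ≤ κ * √D / δ := by gcongr
  have hl0 : 0 ≤ Real.log (κ * √D / δ) := Real.log_nonneg (hδi.trans harg)
  have hκ32 : κ ≤ κ ^ (3 / 2 : ℝ) := by
    conv_lhs => rw [← Real.rpow_one κ]
    exact Real.rpow_le_rpow_of_exponent_le hκ (by norm_num)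
  -- The case where the logarithm has no uniform positive lower bound: time 0 already suffices.
  by_cases hcase : D < 2 ∧ 1 - r ≤ δ
  · obtain ⟨t, ht, ht0⟩ := exists_isMixingTime_le ((hzero hcase.1).trans hcase.2)
    refine ⟨t, ht, ?_⟩
    rw [Nat.le_zero.1 ht0]
    have : 0 ≤ κ ^ (3 / 2 : ℝ) := by positivity
    push_cast
    positivity
  -- This lower bound lets the constant `Real.log A` and the rounding error 1 be absorbed into
  -- multiples of the logarithm. For `D ≥ 2` it uses `r ≤ 1 / 4 < log √2`.
  have hl : r ≤ Real.log (κ * √D / δ) := by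
    by_cases hD2 : D < 2
    · have hδr : δ < 1 - r := by
        by_contra hcon
        exact hcase ⟨hD2, not_lt.1 hcon⟩
      have h1 : r ≤ Real.log (1 / δ) := by
        rw [one_div, Real.log_inv]
        have := Real.log_le_sub_one_of_pos hδ
        linarith
      exact h1.trans (Real.log_le_log (by positivity) harg)
    · have h1 : √2 ≤ κ * √D / δ := by
        calc √2 ≤ √D := Real.sqrt_le_sqrt (not_lt.1 hD2)
          _ ≤ κ * √D := by nlinarith
          _ ≤ κ * √D / δ := by rw [le_div_iff₀ hδ]; nlinarith
      have h2 : Real.log √2 ≤ Real.log (κ * √D / δ) := Real.log_le_log (by positivity) h1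
      rw [Real.log_sqrt (by norm_num)] at h2
      linarith [Real.log_two_gt_d9]
  have hADδ : 1 ≤ A * D / δ := by
    rw [le_div_iff₀ hδ]; nlinarith
  have hlog : Real.log (A * D / δ) ≤ Real.log A + 2 * Real.log (κ * √D / δ) := by
    have h1 : A * D / δ ≤ A * (κ * √D / δ) ^ 2 := by
      rw [mul_div_assoc]
      gcongr
      rw [div_pow, mul_pow, Real.sq_sqrt (by linarith), div_le_div_iff₀ hδ (by positivity)]
      have h2 : D ≤ κ ^ 2 * D :=
        le_mul_of_one_le_left (by linarith) (one_le_pow₀ hκ)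
      have h3 : δ ^ 2 ≤ δ := by nlinarith
      have h4 : 0 ≤ D := by linarith
      calc D * δ ^ 2 ≤ D * δ := by gcongr
        _ ≤ κ ^ 2 * D * δ := by gcongr
    calc Real.log (A * D / δ) ≤ Real.log (A * (κ * √D / δ) ^ 2) :=
          Real.log_le_log (by positivity) h1
      _ = Real.log A + 2 * Real.log (κ * √D / δ) := by
          rw [Real.log_mul (by positivity) (by positivity), Real.log_pow]
          norm_num
  set k := ⌈κ / p * Real.log (A * D / δ)⌉₊ with hk
  have hk1 : κ / p * Real.log (A * D / δ) ≤ k := Nat.le_ceil _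
  have hk2 : (k : ℝ) ≤ κ / p * Real.log (A * D / δ) + 1 :=
    (Nat.ceil_lt_add_one (mul_nonneg (by positivity) (Real.log_nonneg hADδ))).le
  have htv : tvDist (P k) Q ≤ δ := by
    refine (hbound k).trans ?_
    have h1 : (1 - p / κ) ^ k ≤ Real.exp (-(p / κ * k)) := by
      calc (1 - p / κ) ^ k ≤ Real.exp (-(p / κ)) ^ k := by
            have := Real.add_one_le_exp (-(p / κ))
            exact pow_le_pow_left₀ (by linarith) (by linarith) k
        _ = Real.exp (-(p / κ * k)) := by
            rw [← Real.exp_nat_mul]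
            congr 1
            ring
    have h2 : Real.log (A * D / δ) ≤ p / κ * k := by
      calc Real.log (A * D / δ) = p / κ * (κ / p * Real.log (A * D / δ)) := by field_simp
        _ ≤ p / κ * k := by gcongr
    have h3 : Real.exp (-(p / κ * k)) ≤ (A * D / δ)⁻¹ := by
      rw [← Real.exp_log (show 0 < A * D / δ by positivity), ← Real.exp_neg]
      exact Real.exp_le_exp.2 (neg_le_neg h2)
    calc A * D * (1 - p / κ) ^ k ≤ A * D * (A * D / δ)⁻¹ := by
          gcongr
          exact h1.trans h3
      _ = δ := by field_simp
  obtain ⟨t, ht, htk⟩ := exists_isMixingTime_le htv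
  refine ⟨t, ht, ?_⟩
  set l := Real.log (κ * √D / δ)
  have htR : (t : ℝ) ≤ k := by exact_mod_cast htk
  have hA' : Real.log A ≤ Real.log A / r * l := by
    rw [div_mul_eq_mul_div, le_div_iff₀ hr]
    gcongr
  have h1' : (1 : ℝ) ≤ κ * (1 / r * l) := by
    have : 1 ≤ 1 / r * l := by rw [one_div, ← div_eq_inv_mul, le_div_iff₀ hr]; linarith
    nlinarith
  calc (t : ℝ) ≤ κ / p * (Real.log A + 2 * l) + 1 := by
        have : κ / p * Real.log (A * D / δ) ≤ κ / p * (Real.log A + 2 * l) := by gcongr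
        linarith
    _ ≤ κ / p * (Real.log A / r * l + 2 * l) + κ * (1 / r * l) := by gcongr
    _ = ((Real.log A / r + 2) / p + 1 / r) * (κ * l) := by ring
    _ ≤ _ := by gcongr

end Mixing

/-! ### Uniform constants and assembly. -/

lemma half_min_mem_allowedSteps {d : ℕ} {S : Matrix (Fin d) (Fin d) ℝ} {ξmin : ℝ}
    (hmin : IsLeast (spectrum ℝ S) ξmin) (hpos : 0 < ξmin) :
    ξmin / 2 ∈ allowedSteps S (ξmin / 3) := by
  refine ⟨by positivity, fun ξ hξ => ?_⟩
  have hle : ξmin ≤ ξ := hmin.2 hξ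
  have hξ0 : 0 < ξ := hpos.trans_le hle
  have hs : √((ξ + ξmin / 3) / (2 * (ξmin / 3))) ≤ 4 * (ξ / ξmin) - 1 := by
    have hx : 1 ≤ ξ / ξmin := (one_le_div hpos).2 hle
    have harg : (ξ + ξmin / 3) / (2 * (ξmin / 3)) = (3 * (ξ / ξmin) + 1) / 2 := by
      field_simp
    rw [harg]
    refine Real.sqrt_le_iff.2 ⟨by linarith, ?_⟩
    nlinarith
  have hΔ : stepDelta ξ (ξmin / 3) ≤ 2 * (ξ / ξmin) := by
    rw [stepDelta]; linarith
  have hΔ0 : 0 < stepDelta ξ (ξmin / 3) := by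
    rw [stepDelta]; positivity
  calc ξmin / 2 * ξ⁻¹ = 1 / (2 * (ξ / ξmin)) := by field_simp
    _ ≤ 1 / stepDelta ξ (ξmin / 3) := by gcongr

lemma basisGaussian_tvDist_le_of_two_sided {b : OrthonormalBasis (Fin 1) ℝ
    (EuclideanSpace ℝ (Fin 1))} {c c' : Fin 1 → NNReal} (hc : 0 < c 0) (hc' : 0 < c' 0) {r : ℝ}
    (h1 : r ≤ √((c 0 : ℝ) / c' 0)) (h2 : r ≤ √((c' 0 : ℝ) / c 0)) :
    tvDist (basisGaussian b c) (basisGaussian b c') ≤ 1 - r := by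
  rcases le_total (c 0) (c' 0) with h | h
  · refine (tvDist_basisGaussian_le_of_le b (Fin.forall_fin_one.2 hc)
      (Fin.forall_fin_one.2 h)).trans ?_
    rw [Fin.prod_univ_one]; linarith
  · rw [tvDist_comm]
    refine (tvDist_basisGaussian_le_of_le b (Fin.forall_fin_one.2 hc')
      (Fin.forall_fin_one.2 h)).trans ?_
    rw [Fin.prod_univ_one]; linarith

/-- Both the initial normalized variance $3t\gamma/\beta$ and $q=2t(1+t)$ are of order $t$, so `p`
can be chosen independently of `t`, however small `t` is. -/
lemma initial_variance_condition {β c γ p t : ℝ} (hβ : 0 < β) (hc : 0 < c) (hγ : c ≤ γ)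
    (hp2 : p ≤ 1 / 2) (hpc : p ≤ 9 * c / (16 * β)) (ht : 0 < t) (ht3 : t ≤ 1 / 3) :
    p * (3 * t * γ / β + 2 * t * (1 + t)) ≤ 3 * t * γ / β := by
  have h3 : 3 * t * c / β ≤ 3 * t * γ / β := by gcongr
  have h4 : p * (2 * t * (1 + t)) ≤ 9 * c / (16 * β) * (2 * t * (1 + 1 / 3)) := by
    gcongr
  have h5 : 9 * c / (16 * β) * (2 * t * (1 + 1 / 3)) = (3 * t * c / β) / 2 := by
    field_simp; norm_num
  have h6 : 0 < 3 * t * γ / β := by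
    have : 0 < γ := hc.trans_le hγ
    positivity
  nlinarith

set_option maxHeartbeats 1000000 in
/-- Mixing with a constant depending only on `β` and bounds on the normalized initial variance. -/
theorem exists_mixesFast_constant {β c₁ c₂ : ℝ} (hβ : 0 < β) (hc₁ : 0 < c₁) (hc₂ : c₁ ≤ c₂) :
    ∃ C : ℝ, 0 < C ∧
      ∀ (d : ℕ) (S : Matrix (Fin d) (Fin d) ℝ) (L m ξmin T η γ : ℝ),
        S.PosDef →
        IsGreatest (spectrum ℝ S⁻¹) L → IsLeast (spectrum ℝ S⁻¹) m →
        IsLeast (spectrum ℝ S) ξmin → T = ξmin / 3 →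
        IsGreatest (allowedSteps S T) η → c₁ ≤ γ → γ ≤ c₂ →
        0 < L ∧ T = L⁻¹ / 3 ∧ MixesFast S β T η (L⁻¹ * γ) (L / m) C := by
  have hc₂0 : 0 < c₂ := hc₁.trans_le hc₂
  set p : ℝ := min (1 / 2) (9 * c₁ / (16 * β)) with hp
  have hp0 : 0 < p := lt_min (by norm_num) (by positivity)
  have hp2 : p ≤ 1 / 2 := min_le_left _ _
  have hpc : p ≤ 9 * c₁ / (16 * β) := min_le_right _ _
  -- In dimension one the stationary variance is $\tfrac89\beta L^{-1}$; the square roots bound from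
  -- below those of the two ratios between it and $L^{-1}\gamma$.
  set r : ℝ := min (1 / 4) (min √(9 * c₁ / (8 * β)) √(8 * β / (9 * c₂))) with hr
  have hr0 : 0 < r := lt_min (by norm_num) (lt_min (by positivity) (by positivity))
  -- Twice `9 / 8`, from dividing by `w ≥ 8 / 9`, times a bound for the initial error.
  set A : ℝ := 9 / 4 * (1 + c₂ / β) with hA
  have hA1 : 1 ≤ A := by
    have : 0 < c₂ / β := by positivity
    linarith
  have hlogA := Real.log_nonneg hA1
  refine ⟨(Real.log A / r + 2) / (p / 2) + 1 / r, by positivity, ?_⟩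
  intro d S L m ξmin T η γ hS hL hm hξ hT hη hγ₁ hγ₂
  have hγ0 : 0 < γ := hc₁.trans_le hγ₁
  set b := hS.isHermitian.eigenvectorBasis with hb
  set ξ := hS.isHermitian.eigenvalues with hξdef
  have hξ0 : ∀ i, 0 < ξ i := hS.eigenvalues_pos
  obtain ⟨iL, hiL⟩ := (mem_spectrum_inv_iff_exists_eigenvalue hS L).1 hL.1
  obtain ⟨im, him⟩ := (mem_spectrum_inv_iff_exists_eigenvalue hS m).1 hm.1
  obtain ⟨ix, hix⟩ := (mem_spectrum_iff_exists_eigenvalue hS ξmin).1 hξ.1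
  have hL0 : 0 < L := by rw [hiL]; exact inv_pos.2 (hξ0 iL)
  have hm0 : 0 < m := by rw [him]; exact inv_pos.2 (hξ0 im)
  have hx0 : 0 < ξmin := by rw [hix]; exact hξ0 ix
  have hle : ∀ i, (ξ i)⁻¹ ≤ L := fun i =>
    hL.2 ((mem_spectrum_inv_iff_exists_eigenvalue hS _).2 ⟨i, rfl⟩)
  have hge : ∀ i, m ≤ (ξ i)⁻¹ := fun i =>
    hm.2 ((mem_spectrum_inv_iff_exists_eigenvalue hS _).2 ⟨i, rfl⟩)
  have hmL : m ≤ L := (hge iL).trans (hle iL)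
  have hxL : ξmin = L⁻¹ := by
    refine le_antisymm ?_ ?_
    · rw [hiL, inv_inv]
      exact hξ.2 ((mem_spectrum_iff_exists_eigenvalue hS _).2 ⟨iL, rfl⟩)
    · rw [inv_le_comm₀ hL0 hx0, hix]
      exact hle ix
  have hTL : T = L⁻¹ / 3 := by rw [hT, hxL]
  refine ⟨hL0, hTL, ?_⟩
  have hT0 : 0 < T := by rw [hT]; positivity
  have hη0 : 0 < η := hη.1.1
  have hηlow : L⁻¹ / 2 ≤ η := by
    rw [← hxL]
    exact hη.2 (hT ▸ half_min_mem_allowedSteps hξ hx0)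
  have ha0 : ∀ i, 0 < (ξ i)⁻¹ := fun i => inv_pos.2 (hξ0 i)
  have htaL : ∀ i, T * (ξ i)⁻¹ = (ξ i)⁻¹ / L / 3 := fun i => by rw [hTL]; field_simp
  have ht3 : ∀ i, T * (ξ i)⁻¹ ≤ 1 / 3 := fun i => by
    have : (ξ i)⁻¹ / L ≤ 1 := div_le_one_of_le₀ (hle i) hL0.le
    rw [htaL]; linarith
  have hstep : ∀ i, η * (ξ i)⁻¹ < 1 ∧ (η * (ξ i)⁻¹) ^ 2 * (1 - T * (ξ i)⁻¹) ≤
      8 * (T * (ξ i)⁻¹) * (1 - η * (ξ i)⁻¹) := fun i =>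
    step_size_condition (hξ0 i) hT0 hη0 (ht3 i)
      (hη.1.2 _ ((mem_spectrum_iff_exists_eigenvalue hS _).2 ⟨i, rfl⟩))
  obtain ⟨s, hs⟩ : ∃ s : NNReal, (s : ℝ) = L⁻¹ * γ := ⟨⟨L⁻¹ * γ, by positivity⟩, rfl⟩
  have hs0 : 0 < s := by
    rw [← NNReal.coe_pos, hs]
    positivity
  have hw89 : ∀ i, 8 / 9 ≤ 1 - (T * (ξ i)⁻¹) ^ 2 := fun i => by
    have h1 := ht3 i
    have h2 : 0 < T * (ξ i)⁻¹ := mul_pos hT0 (ha0 i)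
    nlinarith
  have hpos : ∀ i, 0 < β * (1 - (T * (ξ i)⁻¹) ^ 2) * ξ i := fun i =>
    mul_pos (mul_pos hβ (by linarith [hw89 i])) (hξ0 i)
  obtain ⟨e, he⟩ : ∃ e : Fin d → NNReal, ∀ i, (e i : ℝ) = β * (1 - (T * (ξ i)⁻¹) ^ 2) * ξ i :=
    ⟨fun i => ⟨_, (hpos i).le⟩, fun i => rfl⟩
  have he0 : ∀ i, 0 < e i := fun i => by
    rw [← NNReal.coe_pos, he]
    exact hpos i
  have hv0 : ∀ i, (ξ i)⁻¹ * s / β = 3 * (T * (ξ i)⁻¹) * γ / β := fun i => by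
    rw [hs, hTL]; field_simp
  have hiter := fun i k => iterate_nextVariance (ha0 i) hβ hT0 hη0 (ht3 i) (hstep i).1
    (hstep i).2 hp0 hp2 hs0 (by
      rw [hv0]
      exact initial_variance_condition hβ hc₁ hγ₁ hp2 hpc (mul_pos hT0 (ha0 i)) (ht3 i)) k
  have hlaw : ∀ k, law (quadPotential S) β T η (isoGaussian d (L⁻¹ * γ)) k =
      basisGaussian b fun i => (nextVariance (ξ i)⁻¹ β T η)^[k] s := fun k => by
    rw [← hs, isoGaussian_eq b]
    exact law_basisGaussian b ha0 hβ hT0 η (quadPotential_eq hS) (fun k i => (hiter i k).1) k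
  have hstat : stationary S β T = basisGaussian b e := stationary_eq hS β T e he
  have hκ : 1 ≤ L / m := (one_le_div hm0).2 hmL
  have hpκ : p / 2 / (L / m) ≤ 1 := div_le_one_of_le₀ (by linarith) (by positivity)
  -- A largest eigenvalue exists, so the spectrum is nonempty.
  have hd : d ≠ 0 := fun h => by subst h; exact iL.elim0
  have hd1 : (1 : ℝ) ≤ d := by exact_mod_cast Nat.one_le_iff_ne_zero.2 hd
  -- The slowest coordinate has curvature `m`, and `η ≥ L⁻¹ / 2`.
  have hrate : ∀ i, p / 2 / (L / m) ≤ η * (ξ i)⁻¹ * p := fun i => by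
    calc p / 2 / (L / m) = L⁻¹ / 2 * m * p := by field_simp
      _ ≤ η * (ξ i)⁻¹ * p := by
        gcongr
        exact hge i
  refine tendsto_and_exists_isMixingTime hA1 hd1 (by positivity) (by linarith) hκ hr0
    (min_le_left _ _) (fun k => ?_) (fun hd2 => ?_)
  · rw [hlaw, hstat]
    have hε : 0 ≤ 9 / 8 * (1 + c₂ / β) * (1 - p / 2 / (L / m)) ^ k :=
      mul_nonneg (by positivity) (pow_nonneg (by linarith) k)
    refine (tvDist_basisGaussian_le b (fun i => (hiter i k).1) he0 hε fun i => ?_).trans_eq ?_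
    · set c := (nextVariance (ξ i)⁻¹ β T η)^[k] s
      set w := 1 - (T * (ξ i)⁻¹) ^ 2 with hw
      have hwi : 8 / 9 ≤ w := hw89 i
      have hratio : (c : ℝ) / e i - 1 = ((ξ i)⁻¹ * c / β - w) / w := by
        have := hξ0 i
        have : 0 < w := by linarith
        rw [he, ← hw]
        field_simp
      have hinit : |(ξ i)⁻¹ * s / β - w| ≤ 1 + c₂ / β := by
        have h1 : 0 < (ξ i)⁻¹ * s / β :=
          div_pos (mul_pos (ha0 i) hs0) hβ
        have h2 : (ξ i)⁻¹ * s / β ≤ c₂ / β := by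
          rw [hv0]
          have := ht3 i
          have h3 : 3 * (T * (ξ i)⁻¹) * γ ≤ 1 * c₂ := by
            gcongr
            linarith
          rw [one_mul] at h3
          gcongr
        have h3 : w ≤ 1 := by rw [hw]; nlinarith [sq_nonneg (T * (ξ i)⁻¹)]
        rw [abs_le]
        constructor <;> linarith
      have hstep1 : (1 - η * (ξ i)⁻¹ * p) ^ k ≤ (1 - p / 2 / (L / m)) ^ k := by
        refine pow_le_pow_left₀ ?_ (by linarith [hrate i]) k
        nlinarith [(hstep i).1, mul_pos hη0 (ha0 i)]
      rw [hratio, abs_div, abs_of_pos (show 0 < w by linarith), div_le_iff₀ (by linarith)]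
      calc |(ξ i)⁻¹ * c / β - w| ≤
            (1 - η * (ξ i)⁻¹ * p) ^ k * |(ξ i)⁻¹ * s / β - w| := (hiter i k).2.2
        _ ≤ (1 - p / 2 / (L / m)) ^ k * (1 + c₂ / β) :=
            mul_le_mul hstep1 hinit (abs_nonneg _) (pow_nonneg (by linarith) k)
        _ = 9 / 8 * (1 + c₂ / β) * (1 - p / 2 / (L / m)) ^ k * (8 / 9) := by ring
        _ ≤ 9 / 8 * (1 + c₂ / β) * (1 - p / 2 / (L / m)) ^ k * w := by gcongr
    · rw [hA]; ring
  · have hd2' : d < 2 := by exact_mod_cast hd2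
    obtain rfl : d = 1 := by omega
    rw [hlaw, hstat]
    have hξL : ξ 0 = L⁻¹ := by rw [hiL, inv_inv, Subsingleton.elim iL 0]
    have he' : (e 0 : ℝ) = 8 / 9 * β * L⁻¹ := by
      rw [he, hξL, hTL]; field_simp; norm_num
    refine basisGaussian_tvDist_le_of_two_sided hs0 (he0 0) ?_ ?_
    · refine ((min_le_right _ _).trans (min_le_left _ _)).trans (Real.sqrt_le_sqrt ?_)
      simp only [Function.iterate_zero, id_eq]
      calc 9 * c₁ / (8 * β) ≤ 9 * γ / (8 * β) := by gcongr
        _ = s / e 0 := by rw [he', hs]; field_simp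
    · refine ((min_le_right _ _).trans (min_le_right _ _)).trans (Real.sqrt_le_sqrt ?_)
      simp only [Function.iterate_zero, id_eq]
      calc 8 * β / (9 * c₂) ≤ 8 * β / (9 * γ) := by gcongr
        _ = e 0 / s := by rw [he', hs]; field_simp

end BRWP

theorem mainTheorem2 (β : ℝ) (hβ : 0 < β) :
    -- initial covariance `L⁻¹ (1 - L² T²) I`
    (∃ C : ℝ, 0 < C ∧
      ∀ (d : ℕ) (S : Matrix (Fin d) (Fin d) ℝ) (L m ξmin T η : ℝ),
        S.PosDef →
        IsGreatest (spectrum ℝ S⁻¹) L → IsLeast (spectrum ℝ S⁻¹) m →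
        IsLeast (spectrum ℝ S) ξmin → T = ξmin / 3 →
        IsGreatest (BRWP.allowedSteps S T) η →
        BRWP.MixesFast S β T η (L⁻¹ * (1 - L ^ 2 * T ^ 2)) (L / m) C) ∧
    -- initial covariance `L⁻¹ (1 - L⁻² T²)⁻¹ I`, wherever it is positive
    (∀ r : ℝ, 0 < r → ∃ C : ℝ, 0 < C ∧
      ∀ (d : ℕ) (S : Matrix (Fin d) (Fin d) ℝ) (L m ξmin T η : ℝ),
        S.PosDef →
        IsGreatest (spectrum ℝ S⁻¹) L → IsLeast (spectrum ℝ S⁻¹) m →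
        IsLeast (spectrum ℝ S) ξmin → T = ξmin / 3 →
        IsGreatest (BRWP.allowedSteps S T) η →
        r ≤ 1 - (L ^ 2)⁻¹ * T ^ 2 →
        BRWP.MixesFast S β T η (L⁻¹ * (1 - (L ^ 2)⁻¹ * T ^ 2)⁻¹) (L / m) C) := by
  refine ⟨?_, fun r hr => ?_⟩
  -- Since $LT=1/3$, the factor $1-L^2T^2$ is exactly $8/9$.
  · obtain ⟨C, hC, h⟩ := BRWP.exists_mixesFast_constant (c₁ := 8 / 9) (c₂ := 8 / 9) hβ
      (by norm_num) le_rfl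
    refine ⟨C, hC, fun d S L m ξmin T η hS hL hm hξ hT hη => ?_⟩
    obtain ⟨hL0, hTL, hmix⟩ := h d S L m ξmin T η (8 / 9) hS hL hm hξ hT hη le_rfl le_rfl
    have h89 : 1 - L ^ 2 * T ^ 2 = 8 / 9 := by rw [hTL]; field_simp; norm_num
    rwa [h89]
  -- Here $\gamma=(1-L^{-2}T^2)^{-1}$ lies in $[1,r^{-1}]$; the maximum keeps `c₁ ≤ c₂` when `r >
  -- 1`.
  · obtain ⟨C, hC, h⟩ := BRWP.exists_mixesFast_constant (c₁ := 1) (c₂ := max 1 r⁻¹) hβ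
      one_pos (le_max_left _ _)
    refine ⟨C, hC, fun d S L m ξmin T η hS hL hm hξ hT hη hrT => ?_⟩
    have h0 : 0 < 1 - (L ^ 2)⁻¹ * T ^ 2 := hr.trans_le hrT
    have h1 : 1 - (L ^ 2)⁻¹ * T ^ 2 ≤ 1 := by
      have : 0 ≤ (L ^ 2)⁻¹ * T ^ 2 := by positivity
      linarith
    exact (h d S L m ξmin T η _ hS hL hm hξ hT hη ((one_le_inv₀ h0).2 h1)
      ((inv_anti₀ hr hrT).trans (le_max_right _ _))).2.2
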